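/- **Setting.** Fix a number $h>0$ of agents and a set of propositions. Formulas are given by $$A ::= p \mid \neg p \mid A\lor A \mid A\land A \mid \Diamond_i A \mid \Box_i A \mid \Diamond^{*} A \mid \Box^{*} A \qquad (1\le i\le h),$$ where $\Box^{*}$ is the common knowledge modality and $\Diamond^{*}$ its dual; the negation $\neg A$ is defined by the De Morgan laws. Write $\Box A=\Box_1A\land\dots\land\Box_hA$ and $\Diamond A=\Diamond_1A\lor\dots\lor\Diamond_hA$ (associated to the left), and let $\Box^kA$ be the $k$-fold iteration of $\Box$ on $A$. The rank of a formula is the ordinal defined by $\mathrm{rk}(p)=\mathrm{rk}(\neg p)=0$, $\mathrm{rk}(A\land B)=\mathrm{rk}(A\lor B)=\max(\mathrm{rk}(A),\mathrm{rk}(B))+1$, $\mathrm{rk}(\Box_iA)=\mathrm{rk}(\Diamond_iA)=\mathrm{rk}(A)+1$, $\mathrm{rk}(\Box^{*}A)=\mathrm{rk}(\Diamond^{*}A)=\omega+\mathrm{rk}(A)$. A (shallow) sequent is a finite multiset of formulas. The system $\mathsf{G_C}$ has the axioms $\Gamma,p,\neg p$ and the rules - from $\Gamma,A$ and $\Gamma,B$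 infer $\Gamma,A\land B$; - from $\Gamma,A,B$ infer $\Gamma,A\lor B$; - from $\Gamma,\Diamond^{*}\Delta,A$ infer $\Diamond_i\Gamma,\Diamond^{*}\Delta,\Box_iA,\Sigma$ (a modality in front of a multiset is prefixed to each of its members); - from $\Gamma,\Box^kA$ for all $k\ge1$ infer $\Gamma,\Box^{*}A$; - from $\Gamma,\Diamond^{*}A,\Diamond A$ infer $\Gamma,\Diamond^{*}A$. The cut rule infers $\Gamma,\Delta$ from $\Gamma,A$ and $\Delta,\neg A$; its rank is $\mathrm{rk}(A)$. Proofs are well-founded, possibly infinitely branching trees. The depth of a proof is the ordinal that is $0$ for an axiom and otherwise the supremum of the ordinals $d+1$, where $d$ ranges over the depths of the immediate subproofs. For ordinals $\alpha,\gamma$ write $\mathsf{G_C}\vdash^{\alpha}_{\gamma}\Gamma$ if $\Gamma$ has a proof of depth at most $\alpha$ in $\mathsf{G_C}$ plus cuts of rank strictly less than $\gamma$; so $\gamma=0$ means that the proof is cut-free. Let $\varphi$ be the binary Veblen function with $\varphi_0(\beta)=\omega^\beta$, so that $\varphi_1(\beta)$ is the $(\beta+1)$-th fixed point of $\xi\mapsto\omega^\xi$,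 and let $\varphi_1^n$ be the $n$-fold iterate of $\varphi_1$. **Theorem (Cut-elimination for the shallow system).** For every sequent $\Gamma$, every ordinal $\alpha$ and every natural number $n$: if $\mathsf{G_C}\vdash^{\alpha}_{\omega\cdot n}\Gamma$, then $\mathsf{G_C}\vdash^{\;\omega\cdot(\varphi_1^n(\omega\cdot\alpha)+1)}_{0}\Gamma$. -/

import Mathlib

universe u v

namespace CommonKnowledge

/-- Formulas of the logic of common knowledge with `h` agents (the agents `1, …, h` are the
elements `0, …, h - 1` of `Fin h`), over a set `P` of propositions, in negation normal form.
`ckdia` and `ckbox` are the common knowledge modalities. -/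
inductive Formula (h : ℕ) (P : Type u) : Type u
  | pos (p : P) : Formula h P
  | neg (p : P) : Formula h P
  | or (A B : Formula h P) : Formula h P
  | and (A B : Formula h P) : Formula h P
  | dia (i : Fin h) (A : Formula h P) : Formula h P
  | box (i : Fin h) (A : Formula h P) : Formula h P
  | ckdia (A : Formula h P) : Formula h P
  | ckbox (A : Formula h P) : Formula h P

namespace Formula

variable {h : ℕ} {P : Type u}

/-- Negation, by the De Morgan laws. -/
def negation : Formula h P → Formula h P
  | pos p => neg p
  | neg p => pos p
  | or A B => and A.negation B.negation
  | and A B => or A.negation B.negation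
  | dia i A => box i A.negation
  | box i A => dia i A.negation
  | ckdia A => ckbox A.negation
  | ckbox A => ckdia A.negation

/-- "Everybody knows `A`": the left-associated conjunction `□₁ A ∧ … ∧ □ₕ A` (for `h > 0`). -/
def everyBox [NeZero h] (A : Formula h P) : Formula h P :=
  (List.finRange h).tail.foldl (fun B i => and B (box i A)) (box 0 A)

/-- The dual of `everyBox`: the left-associated disjunction `◇₁ A ∨ … ∨ ◇ₕ A` (for `h > 0`). -/
def everyDia [NeZero h] (A : Formula h P) : Formula h P :=
  (List.finRange h).tail.foldl (fun B i => or B (dia i A)) (dia 0 A)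

/-- The rank of a formula. -/
noncomputable def rk : Formula h P → Ordinal.{v}
  | pos _ => 0
  | neg _ => 0
  | or A B => max A.rk B.rk + 1
  | and A B => max A.rk B.rk + 1
  | dia _ A => A.rk + 1
  | box _ A => A.rk + 1
  | ckdia A => Ordinal.omega0 + A.rk
  | ckbox A => Ordinal.omega0 + A.rk

end Formula

/-- A shallow sequent is a finite multiset of formulas. -/
abbrev Sequent (h : ℕ) (P : Type u) : Type u := Multiset (Formula h P)

/-- Proofs of sequents in the shallow system `G_C` extended by the cut rule restricted to cut
formulas of rank strictly smaller than `γ`. Being an inductive family, these are exactly the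
well-founded (possibly infinitely branching) trees built by the rules with axioms at the leaves.
For `γ = 0` there are no instances of `cut`, so these are the cut-free proofs. -/
inductive GCProof {h : ℕ} [NeZero h] {P : Type u} (γ : Ordinal.{v}) : Sequent h P → Type u
  | identity (Γ : Sequent h P) (p : P) :
      GCProof γ (Γ + {Formula.pos p, Formula.neg p})
  | and (Γ : Sequent h P) (A B : Formula h P) :
      GCProof γ (Γ + {A}) → GCProof γ (Γ + {B}) → GCProof γ (Γ + {Formula.and A B})
  | or (Γ : Sequent h P) (A B : Formula h P) :
      GCProof γ (Γ + {A, B}) → GCProof γ (Γ + {Formula.or A B})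
  | box (i : Fin h) (Γ Δ Sigma : Sequent h P) (A : Formula h P) :
      GCProof γ (Γ + Δ.map Formula.ckdia + {A}) →
        GCProof γ (Γ.map (Formula.dia i) + Δ.map Formula.ckdia + {Formula.box i A} + Sigma)
  | ckbox (Γ : Sequent h P) (A : Formula h P) :
      (∀ k : {k : ℕ // 1 ≤ k}, GCProof γ (Γ + {Formula.everyBox^[k.1] A})) →
        GCProof γ (Γ + {Formula.ckbox A})
  | ckdia (Γ : Sequent h P) (A : Formula h P) :
      GCProof γ (Γ + {Formula.ckdia A, Formula.everyDia A}) → GCProof γ (Γ + {Formula.ckdia A})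
  | cut (Γ Δ : Sequent h P) (A : Formula h P) (hA : A.rk < γ) :
      GCProof γ (Γ + {A}) → GCProof γ (Δ + {A.negation}) → GCProof γ (Γ + Δ)

/-- The depth of a proof: axioms have depth `0`, and any other proof has as its depth the least
ordinal strictly above the depths of its immediate subproofs. -/
noncomputable def GCProof.depth {h : ℕ} [NeZero h] {P : Type u} {γ : Ordinal.{v}} :
    {Γ : Sequent h P} → GCProof γ Γ → Ordinal.{v}
  | _, identity _ _ => 0
  | _, and _ _ _ π₁ π₂ => max (π₁.depth + 1) (π₂.depth + 1)
  | _, or _ _ _ π => π.depth + 1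
  | _, box _ _ _ _ _ π => π.depth + 1
  | _, ckbox _ _ π => ⨆ k, ((π k).depth + 1)
  | _, ckdia _ _ π => π.depth + 1
  | _, cut _ _ _ _ π₁ π₂ => max (π₁.depth + 1) (π₂.depth + 1)

/-- There is a proof of `Γ` in `G_C` plus cuts of rank `< γ`, with depth bounded by `α`. -/
def GCProves {h : ℕ} [NeZero h] {P : Type u} (α γ : Ordinal.{v}) (Γ : Sequent h P) : Prop :=
  ∃ π : GCProof γ Γ, π.depth ≤ α

end CommonKnowledge

/-!
# Cut elimination for the shallow system of common knowledge

For `n = 0` the given proof is already cut-free. For `n > 0` the bound is at least `ω * ω`, and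
the theorem follows from two facts: the system with cuts is sound for Kripke models, and every
valid sequent has a cut-free proof of depth below `ω * ω`.

For the second fact, fix a finite closed set `C` of formulas. Among the bounds `ω * (j + 1)` there
are two consecutive ones for which the same saturated subsets of `C` are refutable, since `C` has
only finitely many subsets. These refutable sets are the worlds of a countermodel: if no world
reachable from `S` contained `A`, then all premises of the infinitary rule for `□* A` would be
provable below the smaller bound, and so its conclusion would be provable below the larger one.
-/

namespace CommonKnowledge

open Ordinal

variable {h : ℕ} {P : Type u}

/-! ### Kripke semantics and soundness -/

/-! The given proof serves only through soundness when `n > 0`: neither its depth nor its cuts are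
analysed, and the cut-free proof is rebuilt from validity. Finitary rules keep depths below a limit
ordinal, whereas the infinitary rule may lead from `ω * (j + 1)` to the next multiple of `ω`. The
countermodel argument (`not_holds_canonical`) needs such a passage to cost nothing, which holds once
the family of refutable sets stops shrinking. Worlds are sets, so that there are finitely many; the
unprovable sequents are multisets. The two levels are linked by `IsSaturation`, and
`provableBelow_iterate_everyBox` accepts any sequent covering the diamonds of a world, so
contraction is never needed. -/

/-- Truth of a formula at a world of a Kripke model. The common knowledge modalities refer to the
worlds reachable in at least one step. -/
def Holds {W : Type*} (R : Fin h → W → W → Prop) (V : P → W → Prop) : W → Formula h P → Prop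
  | w, .pos p => V p w
  | w, .neg p => ¬ V p w
  | w, .or A B => Holds R V w A ∨ Holds R V w B
  | w, .and A B => Holds R V w A ∧ Holds R V w B
  | w, .dia i A => ∃ w', R i w w' ∧ Holds R V w' A
  | w, .box i A => ∀ w', R i w w' → Holds R V w' A
  | w, .ckdia A => ∃ w', Relation.TransGen (fun a b => ∃ i, R i a b) w w' ∧ Holds R V w' A
  | w, .ckbox A => ∀ w', Relation.TransGen (fun a b => ∃ i, R i a b) w w' → Holds R V w' A

section Semantics

variable {W : Type*} {R : Fin h → W → W → Prop} {V : P → W → Prop}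

theorem holds_negation (A : Formula h P) (w : W) :
    Holds R V w A.negation ↔ ¬ Holds R V w A := by
  induction A generalizing w <;> simp_all [Holds, Formula.negation]; tauto

theorem mem_tail_finRange [NeZero h] (i : Fin h) : i = 0 ∨ i ∈ (List.finRange h).tail := by
  obtain ⟨m, rfl⟩ := Nat.exists_eq_succ_of_ne_zero (NeZero.ne h)
  have := List.mem_finRange i
  rw [List.finRange_succ] at this ⊢
  simpa using this

theorem holds_everyBox [NeZero h] (A : Formula h P) (w : W) :
    Holds R V w A.everyBox ↔ ∀ i, Holds R V w (.box i A) := by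
  have key : ∀ (l : List (Fin h)) (B : Formula h P),
      Holds R V w (l.foldl (fun B i => .and B (.box i A)) B) ↔
        Holds R V w B ∧ ∀ i ∈ l, Holds R V w (.box i A) := by
    intro l
    induction l with
    | nil => simp
    | cons i l ih => intro B; simp [ih, Holds, and_assoc]
  rw [Formula.everyBox, key]
  refine ⟨fun H i => ?_, fun H => ⟨H 0, fun i _ => H i⟩⟩
  rcases mem_tail_finRange i with rfl | hi
  exacts [H.1, H.2 i hi]

theorem holds_everyDia [NeZero h] (A : Formula h P) (w : W) :
    Holds R V w A.everyDia ↔ ∃ i, Holds R V w (.dia i A) := by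
  have key : ∀ (l : List (Fin h)) (B : Formula h P),
      Holds R V w (l.foldl (fun B i => .or B (.dia i A)) B) ↔
        Holds R V w B ∨ ∃ i ∈ l, Holds R V w (.dia i A) := by
    intro l
    induction l with
    | nil => simp
    | cons i l ih => intro B; simp [ih, Holds, or_assoc]
  rw [Formula.everyDia, key]
  refine ⟨fun H => H.elim (fun H => ⟨0, H⟩) fun ⟨i, _, H⟩ => ⟨i, H⟩, fun ⟨i, H⟩ => ?_⟩
  rcases mem_tail_finRange i with rfl | hi
  exacts [.inl H, .inr ⟨i, hi, H⟩]

/-- The witness `k` is the length of a path from `w` to `w'`; each step strips one outer `everyBox`.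
-/
theorem exists_holds_iterate_everyBox_imp [NeZero h] {w w' : W}
    (hw : Relation.TransGen (fun a b => ∃ i, R i a b) w w') :
    ∃ k, 1 ≤ k ∧ ∀ A : Formula h P, Holds R V w (Formula.everyBox^[k] A) → Holds R V w' A := by
  induction hw using Relation.TransGen.head_induction_on with
  | single hab =>
    obtain ⟨i, hi⟩ := hab
    exact ⟨1, le_rfl, fun A H => (holds_everyBox A _).1 H i _ hi⟩
  | head hab _ ih =>
    obtain ⟨i, hi⟩ := hab
    obtain ⟨k, _, hk⟩ := ih
    refine ⟨k + 1, by omega, fun A H => hk A ?_⟩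
    rw [Function.iterate_succ_apply'] at H
    exact (holds_everyBox _ _).1 H i _ hi

/-- Every sequent provable with cuts contains, at each world of each Kripke model, a true
formula. -/
theorem GCProof.sound [NeZero h] {γ : Ordinal.{v}} {Γ : Sequent h P} (π : GCProof γ Γ) (w : W) :
    ∃ A ∈ Γ, Holds R V w A := by
  induction π generalizing w with
  | identity Γ p =>
    by_cases hp : V p w
    · exact ⟨.pos p, by simp, hp⟩
    · exact ⟨.neg p, by simp, hp⟩
  | and Γ A B _ _ ih₁ ih₂ =>
    obtain ⟨C, hC, hCw⟩ := ih₁ w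
    obtain ⟨D, hD, hDw⟩ := ih₂ w
    simp only [Multiset.mem_add, Multiset.mem_singleton] at hC hD ⊢
    rcases hC with hC | rfl
    · exact ⟨C, .inl hC, hCw⟩
    rcases hD with hD | rfl
    · exact ⟨D, .inl hD, hDw⟩
    exact ⟨_, .inr rfl, hCw, hDw⟩
  | or Γ A B _ ih =>
    obtain ⟨C, hC, hCw⟩ := ih w
    simp only [Multiset.mem_add, Multiset.mem_singleton, Multiset.insert_eq_cons,
      Multiset.mem_cons] at hC ⊢
    rcases hC with hC | rfl | rfl
    · exact ⟨C, .inl hC, hCw⟩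
    · exact ⟨_, .inr rfl, .inl hCw⟩
    · exact ⟨_, .inr rfl, .inr hCw⟩
  | box i Γ Δ Sigma A _ ih =>
    by_contra! H
    have hbox : ¬ Holds R V w (.box i A) := H _ (by simp)
    simp only [Holds, not_forall] at hbox
    obtain ⟨w', hw, hA⟩ := hbox
    obtain ⟨C, hC, hCw⟩ := ih w'
    simp only [Multiset.mem_add, Multiset.mem_singleton, Multiset.mem_map] at hC
    rcases hC with (hC | ⟨D, hD, rfl⟩) | rfl
    · exact H (.dia i C) (by simp [hC]) ⟨w', hw, hCw⟩
    -- A path from the successor `w'`, prefixed by the step from `w`, makes the same `◇*` formula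
    -- true at `w`.
    · obtain ⟨w'', hw', hD'⟩ := hCw
      exact H (.ckdia D) (by simp [hD]) ⟨w'', .head ⟨i, hw⟩ hw', hD'⟩
    · exact hA hCw
  | ckbox Γ A _ ih =>
    by_contra! H
    refine H (.ckbox A) (by simp) fun w' hw => ?_
    obtain ⟨k, hk, hkA⟩ := exists_holds_iterate_everyBox_imp (P := P) (V := V) hw
    obtain ⟨C, hC, hCw⟩ := ih ⟨k, hk⟩ w
    simp only [Multiset.mem_add, Multiset.mem_singleton] at hC
    rcases hC with hC | rfl
    · exact absurd hCw (H C (by simp [hC]))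
    · exact hkA A hCw
  | ckdia Γ A _ ih =>
    obtain ⟨C, hC, hCw⟩ := ih w
    simp only [Multiset.mem_add, Multiset.mem_singleton, Multiset.insert_eq_cons,
      Multiset.mem_cons] at hC ⊢
    rcases hC with hC | rfl | rfl
    · exact ⟨C, .inl hC, hCw⟩
    · exact ⟨_, .inr rfl, hCw⟩
    · obtain ⟨i, w', hw, hA⟩ := (holds_everyDia A w).1 hCw
      exact ⟨_, .inr rfl, w', .single ⟨i, hw⟩, hA⟩
  | cut Γ Δ A _ _ _ ih₁ ih₂ =>
    obtain ⟨C, hC, hCw⟩ := ih₁ w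
    obtain ⟨D, hD, hDw⟩ := ih₂ w
    simp only [Multiset.mem_add, Multiset.mem_singleton] at hC hD ⊢
    rcases hC with hC | rfl
    · exact ⟨C, .inl hC, hCw⟩
    rcases hD with hD | rfl
    · exact ⟨D, .inr hD, hDw⟩
    exact absurd hCw ((holds_negation C w).1 hDw)

end Semantics

/-! ### Cut-free provability below a bound -/

theorem GCProves.mono [NeZero h] {α β γ : Ordinal.{v}} {Γ : Sequent h P} (H : GCProves α γ Γ)
    (hαβ : α ≤ β) : GCProves β γ Γ :=
  let ⟨π, hπ⟩ := H
  ⟨π, hπ.trans hαβ⟩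

/-- Weakening preserves depth: the context is carried into the premises, except that the box rule
absorbs it in `Sigma` and a cut needs it only on one side. -/
theorem GCProof.exists_weakening [NeZero h] {γ : Ordinal.{v}} {Γ : Sequent h P} (π : GCProof γ Γ)
    (Λ : Sequent h P) : ∃ π' : GCProof γ (Λ + Γ), π'.depth ≤ π.depth := by
  induction π with
  | identity Γ p =>
    rw [← add_assoc]
    exact ⟨.identity _ p, le_rfl⟩
  | and Γ A B _ _ ih₁ ih₂ =>
    rw [← add_assoc] at ih₁ ih₂ ⊢
    obtain ⟨π₁, h₁⟩ := ih₁
    obtain ⟨π₂, h₂⟩ := ih₂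
    exact ⟨.and _ A B π₁ π₂, max_le_max (add_le_add_left h₁ 1) (add_le_add_left h₂ 1)⟩
  | or Γ A B _ ih =>
    rw [← add_assoc] at ih ⊢
    obtain ⟨π, h⟩ := ih
    exact ⟨.or _ A B π, add_le_add_left h 1⟩
  | box i Γ Δ Sigma A π _ =>
    rw [add_comm Λ, add_assoc]
    exact ⟨.box i Γ Δ _ A π, le_rfl⟩
  | ckbox Γ A π₀ ih =>
    have ih' : ∀ k, ∃ π : GCProof γ (Λ + Γ + {Formula.everyBox^[k.1] A}),
        π.depth ≤ (π₀ k).depth := fun k => by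
      rw [add_assoc]
      exact ih k
    rw [← add_assoc]
    choose π h using ih'
    exact ⟨.ckbox _ A π, ciSup_mono bddAbove_of_small fun k => add_le_add_left (h k) 1⟩
  | ckdia Γ A _ ih =>
    rw [← add_assoc] at ih ⊢
    obtain ⟨π, h⟩ := ih
    exact ⟨.ckdia _ A π, add_le_add_left h 1⟩
  | cut Γ Δ A hA _ π₂ ih₁ ih₂ =>
    rw [← add_assoc] at ih₁ ⊢
    obtain ⟨π₁, h₁⟩ := ih₁
    exact ⟨.cut _ _ A hA π₁ π₂, max_le_max (add_le_add_left h₁ 1) le_rfl⟩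

/-- `Γ` has a cut-free proof of depth strictly below `δ`. -/
def ProvableBelow [NeZero h] (δ : Ordinal.{v}) (Γ : Sequent h P) : Prop :=
  ∃ β < δ, GCProves β 0 Γ

namespace ProvableBelow

variable [NeZero h] {δ δ' : Ordinal.{v}} {Γ Γ' : Sequent h P} {A B : Formula h P}

theorem mono (H : ProvableBelow δ Γ) (hδ : δ ≤ δ') : ProvableBelow δ' Γ :=
  let ⟨β, hβ, H⟩ := H
  ⟨β, hβ.trans_le hδ, H⟩

theorem weaken (H : ProvableBelow δ Γ) (hΓ : Γ ≤ Γ') : ProvableBelow δ Γ' := by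
  obtain ⟨Λ, rfl⟩ := Multiset.le_iff_exists_add.1 hΓ
  obtain ⟨β, hβ, π, hπ⟩ := H
  obtain ⟨π', hπ'⟩ := π.exists_weakening Λ
  rw [add_comm]
  exact ⟨β, hβ, π', hπ'.trans hπ⟩

theorem identity {p : P} (hδ : 0 < δ) (hp : .pos p ∈ Γ) (hn : .neg p ∈ Γ) :
    ProvableBelow δ Γ := by
  obtain ⟨Γ, rfl⟩ := Multiset.exists_cons_of_mem hp
  obtain ⟨Γ, rfl⟩ := Multiset.exists_cons_of_mem
    ((Multiset.mem_cons.1 hn).resolve_left (by simp))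
  refine ⟨0, hδ, ?_⟩
  have : Formula.pos p ::ₘ Formula.neg p ::ₘ Γ = Γ + {Formula.pos p, Formula.neg p} := by
    simp [add_comm Γ]
  rw [this]
  exact ⟨.identity Γ p, le_rfl⟩

/-- As `δ` is not a successor, one more finitary inference stays below it. The same reason underlies
the other finitary rules here. -/
theorem and (hδ : Order.IsSuccPrelimit δ) (HA : ProvableBelow δ (A ::ₘ Γ))
    (HB : ProvableBelow δ (B ::ₘ Γ)) : ProvableBelow δ (.and A B ::ₘ Γ) := by
  simp only [← Multiset.singleton_add, add_comm _ Γ] at *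
  obtain ⟨a, ha, π₁, h₁⟩ := HA
  obtain ⟨b, hb, π₂, h₂⟩ := HB
  exact ⟨_, max_lt (hδ.add_one_lt ha) (hδ.add_one_lt hb), .and Γ A B π₁ π₂,
    max_le_max (add_le_add_left h₁ 1) (add_le_add_left h₂ 1)⟩

theorem or (hδ : Order.IsSuccPrelimit δ) (H : ProvableBelow δ (A ::ₘ B ::ₘ Γ)) :
    ProvableBelow δ (.or A B ::ₘ Γ) := by
  have e : A ::ₘ B ::ₘ Γ = Γ + {A, B} := by simp [add_comm Γ]
  rw [e] at H
  rw [← Multiset.singleton_add, add_comm]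
  obtain ⟨a, ha, π, hπ⟩ := H
  exact ⟨_, hδ.add_one_lt ha, .or Γ A B π, add_le_add_left hπ 1⟩

theorem box {i : Fin h} {Γ Δ : Sequent h P} (Sigma : Sequent h P) (hδ : Order.IsSuccPrelimit δ)
    (H : ProvableBelow δ (A ::ₘ (Γ + Δ.map .ckdia))) :
    ProvableBelow δ (.box i A ::ₘ (Γ.map (.dia i) + Δ.map .ckdia + Sigma)) := by
  rw [← Multiset.singleton_add, add_comm] at H
  rw [← Multiset.singleton_add, add_comm, add_right_comm]
  obtain ⟨a, ha, π, hπ⟩ := H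
  exact ⟨_, hδ.add_one_lt ha, .box i Γ Δ Sigma A π, add_le_add_left hπ 1⟩

/-- The depths of the premises may be cofinal in `δ`, so the conclusion is only known to have depth
at most `δ`; hence the larger bound `δ'`. -/
theorem ckbox (hδ : δ < δ') (H : ∀ k, ProvableBelow δ (Formula.everyBox^[k + 1] A ::ₘ Γ)) :
    ProvableBelow δ' (.ckbox A ::ₘ Γ) := by
  simp only [← Multiset.singleton_add, add_comm _ Γ] at *
  have H' : ∀ k : {k : ℕ // 1 ≤ k},
      ∃ π : GCProof (0 : Ordinal.{v}) (Γ + {Formula.everyBox^[k.1] A}), π.depth < δ := by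
    rintro ⟨k, hk⟩
    obtain ⟨k, rfl⟩ := Nat.exists_eq_add_of_le' hk
    obtain ⟨β, hβ, π, hπ⟩ := H k
    exact ⟨π, hπ.trans_lt hβ⟩
  choose π hπ using H'
  refine ⟨δ, hδ, .ckbox Γ A π, ?_⟩
  have : Nonempty {k : ℕ // 1 ≤ k} := ⟨⟨1, le_rfl⟩⟩
  exact ciSup_le fun k => Order.add_one_le_of_lt (hπ k)

theorem everyBox (hδ : Order.IsSuccPrelimit δ) (H : ∀ i, ProvableBelow δ (.box i A ::ₘ Γ)) :
    ProvableBelow δ (A.everyBox ::ₘ Γ) := by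
  have key : ∀ (l : List (Fin h)) (B : Formula h P), ProvableBelow δ (B ::ₘ Γ) →
      ProvableBelow δ (l.foldl (fun B i => .and B (.box i A)) B ::ₘ Γ) := by
    intro l
    induction l with
    | nil => exact fun B HB => HB
    | cons i l ih => exact fun B HB => ih _ (HB.and hδ (H i))
  exact key _ _ (H 0)

theorem everyDia (hδ : Order.IsSuccPrelimit δ)
    (H : ProvableBelow δ (((List.finRange h).map (Formula.dia · A) : Sequent h P) + Γ)) :
    ProvableBelow δ (A.everyDia ::ₘ Γ) := by
  have key : ∀ (l : List (Fin h)) (B : Formula h P),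
      ProvableBelow δ (B ::ₘ ((l.map (Formula.dia · A) : Sequent h P) + Γ)) →
      ProvableBelow δ (l.foldl (fun B i => .or B (.dia i A)) B ::ₘ Γ) := by
    intro l
    induction l with
    | nil => exact fun B HB => by simpa using HB
    | cons i l ih =>
      intro B HB
      refine ih _ (or hδ ?_)
      simpa [← Multiset.cons_coe] using HB
  refine key _ _ ?_
  obtain ⟨m, rfl⟩ := Nat.exists_eq_succ_of_ne_zero (NeZero.ne h)
  simpa [List.finRange_succ, ← Multiset.cons_coe] using H

theorem ckdia (hδ : Order.IsSuccPrelimit δ) (H : ProvableBelow δ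
    (.ckdia A ::ₘ (((List.finRange h).map (Formula.dia · A) : Sequent h P) + Γ))) :
    ProvableBelow δ (.ckdia A ::ₘ Γ) := by
  rw [← Multiset.add_cons] at H
  replace H := everyDia hδ H
  have e : A.everyDia ::ₘ Formula.ckdia A ::ₘ Γ = Γ + {Formula.ckdia A, A.everyDia} := by
    rw [Multiset.cons_swap, add_comm]
    simp
  rw [e] at H
  rw [← Multiset.singleton_add, add_comm]
  obtain ⟨a, ha, π, hπ⟩ := H
  exact ⟨_, hδ.add_one_lt ha, .ckdia Γ A π, add_le_add_left hπ 1⟩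

end ProvableBelow

/-! ### Closed and saturated sets of formulas -/

/-- Closure under subformulas and under passing from `◇* A` to the formulas `◇ᵢ A`. -/
structure IsClosedSet (C : Set (Formula h P)) : Prop where
  and {A B} : .and A B ∈ C → A ∈ C ∧ B ∈ C
  or {A B} : .or A B ∈ C → A ∈ C ∧ B ∈ C
  box {i A} : .box i A ∈ C → A ∈ C
  dia {i A} : .dia i A ∈ C → A ∈ C
  ckbox {A} : .ckbox A ∈ C → A ∈ C
  ckdia {A} : .ckdia A ∈ C → ∀ i, .dia i A ∈ C

theorem IsClosedSet.union {C D : Set (Formula h P)} (hC : IsClosedSet C) (hD : IsClosedSet D) :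
    IsClosedSet (C ∪ D) where
  and H := H.elim (fun H => (hC.and H).imp .inl .inl) fun H => (hD.and H).imp .inr .inr
  or H := H.elim (fun H => (hC.or H).imp .inl .inl) fun H => (hD.or H).imp .inr .inr
  box := Or.imp hC.box hD.box
  dia := Or.imp hC.dia hD.dia
  ckbox := Or.imp hC.ckbox hD.ckbox
  ckdia H i := H.imp (hC.ckdia · i) (hD.ckdia · i)

theorem IsClosedSet.insert {C : Set (Formula h P)} (hC : IsClosedSet C) {A : Formula h P}
    (hA : match A with
      | .and B D | .or B D => B ∈ C ∧ D ∈ C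
      | .box _ B | .dia _ B | .ckbox B => B ∈ C
      | .ckdia B => ∀ i, .dia i B ∈ C
      | _ => True) : IsClosedSet (insert A C) where
  and H := by
    rcases H with rfl | H
    exacts [hA.imp .inr .inr, (hC.and H).imp .inr .inr]
  or H := by
    rcases H with rfl | H
    exacts [hA.imp .inr .inr, (hC.or H).imp .inr .inr]
  box H := by
    rcases H with rfl | H
    exacts [.inr hA, .inr (hC.box H)]
  dia H := by
    rcases H with rfl | H
    exacts [.inr hA, .inr (hC.dia H)]
  ckbox H := by
    rcases H with rfl | H
    exacts [.inr hA, .inr (hC.ckbox H)]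
  ckdia H i := by
    rcases H with rfl | H
    exacts [.inr (hA i), .inr (hC.ckdia H i)]

/-- Finiteness survives `◇* A` because there are finitely many agents, and `□* A` because its
unfoldings `□ᵏ A` are not required to be in the set. -/
theorem exists_finite_isClosedSet_mem (A : Formula h P) :
    ∃ C : Set (Formula h P), C.Finite ∧ IsClosedSet C ∧ A ∈ C := by
  induction A with
  | pos p => exact ⟨{.pos p}, Set.finite_singleton _, by constructor <;> simp, rfl⟩
  | neg p => exact ⟨{.neg p}, Set.finite_singleton _, by constructor <;> simp, rfl⟩
  | or A B ihA ihB =>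
    obtain ⟨C, hCf, hC, hA⟩ := ihA
    obtain ⟨D, hDf, hD, hB⟩ := ihB
    exact ⟨_, (hCf.union hDf).insert _,
      (hC.union hD).insert (A := .or A B) ⟨.inl hA, .inr hB⟩, .inl rfl⟩
  | and A B ihA ihB =>
    obtain ⟨C, hCf, hC, hA⟩ := ihA
    obtain ⟨D, hDf, hD, hB⟩ := ihB
    exact ⟨_, (hCf.union hDf).insert _,
      (hC.union hD).insert (A := .and A B) ⟨.inl hA, .inr hB⟩, .inl rfl⟩
  | dia i A ih =>
    obtain ⟨C, hCf, hC, hA⟩ := ih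
    exact ⟨_, hCf.insert _, hC.insert (A := .dia i A) hA, .inl rfl⟩
  | box i A ih =>
    obtain ⟨C, hCf, hC, hA⟩ := ih
    exact ⟨_, hCf.insert _, hC.insert (A := .box i A) hA, .inl rfl⟩
  | ckbox A ih =>
    obtain ⟨C, hCf, hC, hA⟩ := ih
    exact ⟨_, hCf.insert _, hC.insert (A := .ckbox A) hA, .inl rfl⟩
  | ckdia A ih =>
    obtain ⟨C, hCf, hC, hA⟩ := ih
    have hD : IsClosedSet (Set.range (Formula.dia · A) ∪ C) :=
      { and := fun H => by simpa using (hC.and (by simpa using H)).imp .inr .inr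
        or := fun H => by simpa using (hC.or (by simpa using H)).imp .inr .inr
        box := fun H => .inr (hC.box (by simpa using H))
        dia := by
          rintro i B (⟨j, hj⟩ | H)
          · cases hj
            exact .inr hA
          · exact .inr (hC.dia H)
        ckbox := fun H => .inr (hC.ckbox (by simpa using H))
        ckdia := fun H i => .inr (hC.ckdia (by simpa using H) i) }
    exact ⟨_, ((Set.finite_range _).union hCf).insert _,
      hD.insert (A := .ckdia A) fun i => .inl ⟨i, rfl⟩, .inl rfl⟩

theorem exists_finite_isClosedSet (Γ : Sequent h P) :
    ∃ C : Set (Formula h P), C.Finite ∧ IsClosedSet C ∧ ∀ A ∈ Γ, A ∈ C := by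
  induction Γ using Multiset.induction with
  | empty => exact ⟨∅, Set.finite_empty, by constructor <;> simp, by simp⟩
  | cons A Γ ih =>
    obtain ⟨C, hCf, hC, hA⟩ := exists_finite_isClosedSet_mem A
    obtain ⟨D, hDf, hD, hΓ⟩ := ih
    refine ⟨C ∪ D, hCf.union hDf, hC.union hD, fun B hB => ?_⟩
    rcases Multiset.mem_cons.1 hB with rfl | hB
    exacts [.inl hA, .inr (hΓ B hB)]

/-- A formula which is neither a conjunction nor a disjunction. -/
def Formula.IsInert : Formula h P → Prop
  | .and _ _ => False
  | .or _ _ => False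
  | _ => True

/-- The set `S` is closed under reading the local rules of `G_C` upwards, and the sequent `Γ`
consists of formulas in `S`, among them all those which are neither conjunctions nor
disjunctions. -/
structure IsSaturation (C S : Set (Formula h P)) (Γ : Sequent h P) : Prop where
  subset : S ⊆ C
  and {A B} : .and A B ∈ S → A ∈ S ∨ B ∈ S
  or {A B} : .or A B ∈ S → A ∈ S ∧ B ∈ S
  ckdia {A} : .ckdia A ∈ S → ∀ i, .dia i A ∈ S
  mem_set {A} : A ∈ Γ → A ∈ S
  mem {A} : A ∈ S → A.IsInert → A ∈ Γ

theorem IsSaturation.singleton {C : Set (Formula h P)} {A : Formula h P} (hA : A ∈ C)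
    (hi : A.IsInert) (hck : ∀ B, A ≠ .ckdia B) : IsSaturation C {A} {A} where
  subset := Set.singleton_subset_iff.2 hA
  and := by
    rintro B D rfl
    exact hi.elim
  or := by
    rintro B D rfl
    exact hi.elim
  ckdia := by
    rintro B rfl
    exact absurd rfl (hck B)
  mem_set := by simp
  mem := by simp +contextual

theorem IsSaturation.union {C S T : Set (Formula h P)} {Γ Δ : Sequent h P}
    (hS : IsSaturation C S Γ) (hT : IsSaturation C T Δ) : IsSaturation C (S ∪ T) (Γ + Δ) where
  subset := Set.union_subset hS.subset hT.subset
  and := by grind [hS.and, hT.and]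
  or := by grind [hS.or, hT.or]
  ckdia := by grind [hS.ckdia, hT.ckdia]
  mem_set := by grind [hS.mem_set, hT.mem_set]
  mem := by grind [hS.mem, hT.mem]

/-! ### Saturating an unprovable sequent by reading rules upwards -/

section Saturation

variable [NeZero h] {δ : Ordinal.{v}} {C : Set (Formula h P)}

/-- By induction on `A`, the rule for `A` is read upwards towards an unprovable premise.
Conjunctions and disjunctions vanish from the sequent but stay recorded in `S`. -/
theorem exists_isSaturation_cons (hδ : Order.IsSuccPrelimit δ) (hC : IsClosedSet C)
    {A : Formula h P} (hA : A ∈ C) {Λ : Sequent h P} (hΛ : ¬ ProvableBelow δ (A ::ₘ Λ)) :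
    ∃ S Γ, IsSaturation C S Γ ∧ A ∈ S ∧ ¬ ProvableBelow δ (Γ + Λ) := by
  induction A generalizing Λ with
  | and A B ihA ihB =>
    have key : ∀ S Γ, IsSaturation C S Γ → (A ∈ S ∨ B ∈ S) →
        IsSaturation C (insert (.and A B) S) Γ := fun S Γ hS hAB =>
      { subset := Set.insert_subset hA hS.subset
        and := by grind [hS.and]
        or := by grind [hS.or]
        ckdia := by grind [hS.ckdia]
        mem_set := by grind [hS.mem_set]
        mem := by grind [hS.mem, Formula.IsInert] }
    by_cases H : ProvableBelow δ (A ::ₘ Λ)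
    · have H' : ¬ ProvableBelow δ (B ::ₘ Λ) := fun H' => hΛ (H.and hδ H')
      obtain ⟨S, Γ, hS, hB, hΓ⟩ := ihB (hC.and hA).2 H'
      exact ⟨_, Γ, key S Γ hS (.inr hB), .inl rfl, hΓ⟩
    · obtain ⟨S, Γ, hS, hA, hΓ⟩ := ihA (hC.and hA).1 H
      exact ⟨_, Γ, key S Γ hS (.inl hA), .inl rfl, hΓ⟩
  | or A B ihA ihB =>
    obtain ⟨S, Γ, hS, hAS, hΓ⟩ := ihA (hC.or hA).1 fun H => hΛ (H.or hδ)
    -- The saturation of `A` joins the side sequent while `B` is treated, which is why `Λ` is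
    -- generalized.
    rw [Multiset.add_cons] at hΓ
    obtain ⟨T, Δ, hT, hBT, hΔ⟩ := ihB (hC.or hA).2 hΓ
    have hST := hT.union hS
    refine ⟨insert (.or A B) (T ∪ S), Δ + Γ,
      { subset := Set.insert_subset hA hST.subset
        and := by grind [hST.and]
        or := by grind [hST.or]
        ckdia := by grind [hST.ckdia]
        mem_set := by grind [hST.mem_set]
        mem := by grind [hST.mem, Formula.IsInert] }, .inl rfl, by rwa [add_assoc]⟩
  | ckdia A _ =>
    refine ⟨insert (.ckdia A) (Set.range (Formula.dia · A)),
      .ckdia A ::ₘ ((List.finRange h).map (Formula.dia · A)),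
      { subset := Set.insert_subset hA (Set.range_subset_iff.2 (hC.ckdia hA))
        and := by simp
        or := by simp
        ckdia := by simp
        mem_set := by simp
        mem := by simp }, .inl rfl, fun H => hΛ ?_⟩
    rw [Multiset.cons_add] at H
    exact H.ckdia hδ
  | pos p =>
    exact ⟨{.pos p}, {.pos p}, .singleton hA trivial (by simp), rfl, hΛ⟩
  | neg p =>
    exact ⟨{.neg p}, {.neg p}, .singleton hA trivial (by simp), rfl, hΛ⟩
  | dia i A _ =>
    exact ⟨{.dia i A}, {.dia i A}, .singleton hA trivial (by simp), rfl, hΛ⟩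
  | box i A _ =>
    exact ⟨{.box i A}, {.box i A}, .singleton hA trivial (by simp), rfl, hΛ⟩
  | ckbox A _ =>
    exact ⟨{.ckbox A}, {.ckbox A}, .singleton hA trivial (by simp), rfl, hΛ⟩

theorem exists_isSaturation (hδ : Order.IsSuccPrelimit δ) (hC : IsClosedSet C)
    {Θ : Sequent h P} (hΘ : ∀ A ∈ Θ, A ∈ C) {Λ : Sequent h P} (hΛ : ¬ ProvableBelow δ (Θ + Λ)) :
    ∃ S Γ, IsSaturation C S Γ ∧ (∀ A ∈ Θ, A ∈ S) ∧ ¬ ProvableBelow δ (Γ + Λ) := by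
  induction Θ using Multiset.induction generalizing Λ with
  | empty => exact ⟨∅, 0, by constructor <;> simp, by simp, hΛ⟩
  | cons A Θ ih =>
    rw [Multiset.cons_add] at hΛ
    obtain ⟨S, Γ, hS, hA, hΓ⟩ := exists_isSaturation_cons hδ hC (hΘ A (by simp)) hΛ
    rw [add_left_comm] at hΓ
    obtain ⟨T, Δ, hT, hΘT, hΔ⟩ := ih (fun B hB => hΘ B (by simp [hB])) hΓ
    refine ⟨T ∪ S, Δ + Γ, hT.union hS, fun B hB => ?_, by rwa [add_assoc]⟩
    rcases Multiset.mem_cons.1 hB with rfl | hB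
    exacts [.inr hA, .inl (hΘT B hB)]

end Saturation

/-- Splitting of a sequent into its formulas `◇ᵢ B`, its formulas `◇* B`, and the rest. -/
theorem exists_eq_map_dia_add_map_ckdia_add (i : Fin h) (Γ : Sequent h P) :
    ∃ Γ₁ Δ Sigma : Sequent h P, Γ = Γ₁.map (.dia i) + Δ.map .ckdia + Sigma ∧
      (∀ B, .dia i B ∈ Γ → B ∈ Γ₁) ∧ ∀ B, .ckdia B ∈ Γ → B ∈ Δ := by
  induction Γ using Multiset.induction with
  | empty => exact ⟨0, 0, 0, by simp⟩
  | cons A Γ ih =>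
    obtain ⟨Γ₁, Δ, Sigma, rfl, h₁, h₂⟩ := ih
    by_cases hA : ∃ B, A = .dia i B
    · obtain ⟨B, rfl⟩ := hA
      exact ⟨B ::ₘ Γ₁, Δ, Sigma, by simp, by grind,
        by grind⟩
    by_cases hA' : ∃ B, A = .ckdia B
    · obtain ⟨B, rfl⟩ := hA'
      exact ⟨Γ₁, B ::ₘ Δ, Sigma, by simp, by grind,
        by grind⟩
    exact ⟨Γ₁, Δ, A ::ₘ Sigma, by simp, by grind,
      by grind⟩

/-! ### The canonical countermodel -/

section Canonical

variable [NeZero h] {δ δ' : Ordinal.{v}} {C : Set (Formula h P)}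

/-- The set `S` is a saturation of a sequent without cut-free proofs of depth below `δ`. -/
def IsRefutable (δ : Ordinal.{v}) (C S : Set (Formula h P)) : Prop :=
  ∃ Γ, IsSaturation C S Γ ∧ ¬ ProvableBelow δ Γ

theorem IsRefutable.anti {S : Set (Formula h P)} (H : IsRefutable δ' C S) (hδ : δ ≤ δ') :
    IsRefutable δ C S :=
  let ⟨Γ, hΓ, H⟩ := H
  ⟨Γ, hΓ, fun H' => H (H'.mono hδ)⟩

/-- The accessibility relations of the canonical model. -/
def canonicalRel (δ : Ordinal.{v}) (C : Set (Formula h P)) (i : Fin h)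
    (S T : {S // IsRefutable δ C S}) : Prop :=
  (∀ B, .dia i B ∈ S.1 → B ∈ T.1) ∧ ∀ B, .ckdia B ∈ S.1 → .ckdia B ∈ T.1

/-- The valuation of the canonical model. -/
def canonicalVal (δ : Ordinal.{v}) (C : Set (Formula h P)) (p : P)
    (S : {S // IsRefutable δ C S}) : Prop :=
  .pos p ∉ S.1

/-- The premise of a box inference, followed by upward saturation: if `Γ, □ᵢ A` is not provable
below `δ`, then neither is `Γ', A` for some sequent `Γ'` saturating a successor. -/
theorem exists_canonicalRel_of_not_provableBelow (hδ : Order.IsSuccPrelimit δ)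
    (hC : IsClosedSet C) (S : {S // IsRefutable δ C S}) {i : Fin h} {A : Formula h P}
    {Γ : Sequent h P} (hΓC : ∀ B ∈ Γ, B ∈ C) (hdia : ∀ B, .dia i B ∈ S.1 → .dia i B ∈ Γ)
    (hck : ∀ B, .ckdia B ∈ S.1 → .ckdia B ∈ Γ) (hΓ : ¬ ProvableBelow δ (.box i A ::ₘ Γ)) :
    (A ∈ C → ∃ T, canonicalRel δ C i S T ∧ A ∈ T.1) ∧
    ∃ T, canonicalRel δ C i S T ∧ ∃ Γ', IsSaturation C T.1 Γ' ∧
      ¬ ProvableBelow δ (A ::ₘ Γ') := by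
  obtain ⟨Γ₁, Δ, Sigma, rfl, h₁, h₂⟩ := exists_eq_map_dia_add_map_ckdia_add i Γ
  have H : ¬ ProvableBelow δ (A ::ₘ (Γ₁ + Δ.map .ckdia)) := fun H => hΓ (H.box Sigma hδ)
  have hΘ : ∀ B ∈ Γ₁ + Δ.map .ckdia, B ∈ C := by
    intro B hB
    rcases Multiset.mem_add.1 hB with hB | hB
    · exact hC.dia (hΓC (.dia i B) (by simp [hB]))
    · exact hΓC B (by simp [Multiset.mem_add, hB])
  have hrel : ∀ T : {S // IsRefutable δ C S}, (∀ B ∈ Γ₁ + Δ.map .ckdia, B ∈ T.1) →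
      canonicalRel δ C i S T := fun T hT =>
    ⟨fun B hB => hT B (by simp [h₁ B (hdia B hB)]), fun B hB => hT _ (by simp [h₂ B (hck B hB)])⟩
  constructor
  · intro hA
    obtain ⟨T, Γ', hT, hsub, hΓ'⟩ := exists_isSaturation hδ hC (Λ := 0)
      (Θ := A ::ₘ (Γ₁ + Δ.map .ckdia))
      (fun B hB => (Multiset.mem_cons.1 hB).elim (fun e => e ▸ hA) (hΘ B)) (by simpa using H)
    rw [add_zero] at hΓ'
    exact ⟨⟨T, Γ', hT, hΓ'⟩, hrel _ fun B hB => hsub B (Multiset.mem_cons_of_mem hB),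
      hsub A (Multiset.mem_cons_self _ _)⟩
  -- Here `A` may lie outside `C`, as `□ᵏ A` does in general, so it is kept as an unsaturated side
  -- formula.
  · rw [← Multiset.singleton_add, add_comm] at H
    obtain ⟨T, Γ', hT, hsub, hΓ'⟩ := exists_isSaturation hδ hC hΘ H
    rw [add_comm, Multiset.singleton_add] at hΓ'
    exact ⟨⟨T, Γ', hT, fun H' => hΓ' (H'.weaken (Multiset.le_cons_self _ _))⟩, hrel _ hsub,
      Γ', hT, hΓ'⟩

/-- If no world reachable from `S` contains `A`, then all the sequents `Γ, □ᵏ A` with `Γ`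
covering the diamond formulas in `S` are provable below `δ`. -/
theorem provableBelow_iterate_everyBox (hδ : Order.IsSuccPrelimit δ) (hC : IsClosedSet C)
    {A : Formula h P} (hA : A ∈ C) (k : ℕ) (S : {S // IsRefutable δ C S})
    (hS : ∀ T, Relation.TransGen (fun a b => ∃ i, canonicalRel δ C i a b) S T → A ∉ T.1)
    {Γ : Sequent h P} (hΓC : ∀ B ∈ Γ, B ∈ C) (hdia : ∀ i B, .dia i B ∈ S.1 → .dia i B ∈ Γ)
    (hck : ∀ B, .ckdia B ∈ S.1 → .ckdia B ∈ Γ) :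
    ProvableBelow δ (Formula.everyBox^[k + 1] A ::ₘ Γ) := by
  induction k generalizing S Γ with
  | zero =>
    refine ProvableBelow.everyBox hδ fun i => ?_
    by_contra H
    obtain ⟨T, hT, hAT⟩ :=
      (exists_canonicalRel_of_not_provableBelow hδ hC S hΓC (hdia i) hck H).1 hA
    exact hS T (.single ⟨i, hT⟩) hAT
  | succ k ih =>
    rw [Function.iterate_succ_apply']
    refine ProvableBelow.everyBox hδ fun i => ?_
    by_contra H
    obtain ⟨T, hT, Γ', hΓ', H'⟩ :=
      (exists_canonicalRel_of_not_provableBelow hδ hC S hΓC (hdia i) hck H).2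
    -- Worlds reachable from `T` are reachable from `S`, so the hypothesis passes to `T`. Arguing by
    -- contradiction yields the same bound `δ` for every `k`.
    exact H' (ih T (fun U hU => hS U (.head ⟨i, hT⟩ hU)) (fun B hB => hΓ'.subset (hΓ'.mem_set hB))
      (fun j B hB => hΓ'.mem hB trivial) fun B hB => hΓ'.mem hB trivial)

/-- If refutability does not change from `δ` to `δ'`, then every formula in a refutable set is
false at that set in the canonical model. -/
theorem not_holds_canonical (hδ : Order.IsSuccPrelimit δ) (hδ₀ : 0 < δ) (hδδ' : δ < δ')
    (hC : IsClosedSet C) (hgap : ∀ S, IsRefutable δ C S → IsRefutable δ' C S) (A : Formula h P)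
    (S : {S // IsRefutable δ C S}) (hA : A ∈ S.1) :
    ¬ Holds (canonicalRel δ C) (canonicalVal δ C) S A := by
  obtain ⟨Γ, hΓ, hΓδ⟩ := S.2
  induction A generalizing S Γ with
  | pos p => exact fun H => H hA
  | neg p => exact fun H => H fun hp => hΓδ (.identity hδ₀ (hΓ.mem hp trivial) (hΓ.mem hA trivial))
  | or A B ihA ihB =>
    exact not_or_intro (ihA S (hΓ.or hA).1 Γ hΓ hΓδ) (ihB S (hΓ.or hA).2 Γ hΓ hΓδ)
  | and A B ihA ihB =>
    rcases hΓ.and hA with hA | hB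
    · exact fun H => ihA S hA Γ hΓ hΓδ H.1
    · exact fun H => ihB S hB Γ hΓ hΓδ H.2
  | dia i A ih =>
    rintro ⟨T, hT, H⟩
    obtain ⟨Δ, hΔ, hΔδ⟩ := T.2
    exact ih T (hT.1 A hA) Δ hΔ hΔδ H
  | box i A ih =>
    obtain ⟨Γ', rfl⟩ := Multiset.exists_cons_of_mem (hΓ.mem hA trivial)
    obtain ⟨T, hT, hAT⟩ := (exists_canonicalRel_of_not_provableBelow hδ hC S
      (fun B hB => hΓ.subset (hΓ.mem_set (Multiset.mem_cons_of_mem hB)))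
      (fun B hB => (Multiset.mem_cons.1 (hΓ.mem hB trivial)).resolve_left (by simp))
      (fun B hB => (Multiset.mem_cons.1 (hΓ.mem hB trivial)).resolve_left (by simp))
      hΓδ).1 (hC.box (hΓ.subset hA))
    obtain ⟨Δ, hΔ, hΔδ⟩ := T.2
    exact fun H => ih T hAT Δ hΔ hΔδ (H T hT)
  | ckdia A ih =>
    rintro ⟨T, hST, H⟩
    -- Carrying `◇* A` along the path lets saturation supply `◇ᵢ A` at each intermediate world.
    have key : A ∈ T.1 ∧ .ckdia A ∈ T.1 := by
      clear H
      induction hST with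
      | single hT =>
        obtain ⟨i, hT⟩ := hT
        exact ⟨hT.1 A (hΓ.ckdia hA i), hT.2 A hA⟩
      | @tail U T _ hT ih' =>
        obtain ⟨i, hT⟩ := hT
        obtain ⟨Δ, hΔ, -⟩ := U.2
        exact ⟨hT.1 A (hΔ.ckdia ih'.2 i), hT.2 A ih'.2⟩
    obtain ⟨Δ, hΔ, hΔδ⟩ := T.2
    exact ih T key.1 Δ hΔ hΔδ H
  | ckbox A ih =>
    intro H
    -- The sequent `Γ` is replaced by one unprovable even below `δ'`, possibly a different multiset
    -- for the same set `S`.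
    obtain ⟨Δ, hΔ, hΔδ⟩ := hgap S.1 S.2
    obtain ⟨Δ', rfl⟩ := Multiset.exists_cons_of_mem (hΔ.mem hA trivial)
    refine hΔδ (.ckbox hδδ' fun k => provableBelow_iterate_everyBox hδ hC (hC.ckbox (hΔ.subset hA))
      k S (fun T hT hAT => ?_) (fun B hB => hΔ.subset (hΔ.mem_set (Multiset.mem_cons_of_mem hB)))
      (fun i B hB => ?_) fun B hB => ?_)
    · obtain ⟨Γ', hΓ', hΓδ'⟩ := T.2
      exact ih T hAT Γ' hΓ' hΓδ' (H T hT)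
    · exact (Multiset.mem_cons.1 (hΔ.mem hB trivial)).resolve_left (by simp)
    · exact (Multiset.mem_cons.1 (hΔ.mem hB trivial)).resolve_left (by simp)

end Canonical

/-! ### Completeness and the depth bound -/

/-- Cut-free completeness, with a bound on the depth: a sequent true at all worlds of all Kripke
models has a cut-free proof of depth below `ω * ω`. -/
theorem provableBelow_of_valid [NeZero h] (Γ : Sequent h P)
    (hΓ : ∀ (W : Type u) (R : Fin h → W → W → Prop) (V : P → W → Prop) (w : W),
      ∃ A ∈ Γ, Holds R V w A) :
    ProvableBelow (ω * ω : Ordinal.{v}) Γ := by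
  obtain ⟨C, hCf, hC, hΓC⟩ := exists_finite_isClosedSet Γ
  -- The shift to `j + 1` makes every bound positive, as the axioms require.
  let δ : ℕ → Ordinal.{v} := fun j => ω * ((j + 1 : ℕ) : Ordinal.{v})
  let G : ℕ → Set (Set (Formula h P)) := fun j => {S | IsRefutable (δ j) C S}
  have hδ : ∀ j, δ j < δ (j + 1) := fun j =>
    mul_lt_mul_of_pos_left (by exact_mod_cast Nat.lt_succ_self _) omega0_pos
  have hG : ∀ j, (G j).Finite := fun j => hCf.finite_subsets.subset fun S ⟨_, hS, _⟩ => hS.subset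
  -- The families `G j` decrease with `j`, so one of least cardinality equals its successor.
  obtain ⟨j, hj⟩ : ∃ j, ∀ i, (G j).ncard ≤ (G i).ncard :=
    ⟨_, fun i => Function.argmin_le (fun j => (G j).ncard) i⟩
  have hgap : G (j + 1) = G j :=
    Set.eq_of_subset_of_ncard_le (fun S hS => IsRefutable.anti hS (hδ j).le) (hj _) (hG j)
  by_contra H
  have H' : ¬ ProvableBelow (δ j) (Γ + 0) := by
    rw [add_zero]
    exact fun H' => H (H'.mono (mul_le_mul_right (natCast_lt_omega0 _).le _))
  obtain ⟨S, Δ, hS, hΓS, hΔ⟩ :=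
    exists_isSaturation (isSuccPrelimit_mul_left isSuccLimit_omega0) hC hΓC H'
  rw [add_zero] at hΔ
  obtain ⟨A, hA, hAS⟩ := hΓ {S // IsRefutable (δ j) C S} (canonicalRel _ C) (canonicalVal _ C)
    ⟨S, Δ, hS, hΔ⟩
  exact not_holds_canonical (isSuccPrelimit_mul_left isSuccLimit_omega0)
    (mul_pos omega0_pos (by exact_mod_cast Nat.succ_pos j)) (hδ j) hC
    (fun S hS => hgap.symm.subset hS) A _ (hΓS A hA) hAS

/-- Values of `veblen 1` are fixed points of `ω ^ ·`; such a point is not `0`, hence is at least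
`1`, hence at least `ω ^ 1`. -/
theorem omega0_le_veblen_one (a : Ordinal.{v}) : ω ≤ veblen 1 a := by
  have h1 : ω ^ veblen 1 a = veblen 1 a := by
    rw [← veblen_zero_apply]
    exact veblen_veblen_of_lt zero_lt_one a
  have h2 : veblen 1 a ≠ 0 := fun h0 => by simp [h0] at h1
  calc ω = ω ^ (1 : Ordinal) := (opow_one _).symm
    _ ≤ ω ^ veblen 1 a := opow_le_opow_right omega0_pos (Order.one_le_iff_ne_zero.2 h2)
    _ = veblen 1 a := h1

end CommonKnowledge

theorem mainTheorem10 {h : ℕ} [NeZero h] {P : Type u} (Γ : CommonKnowledge.Sequent h P)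
    (α : Ordinal.{v}) (n : ℕ)
    (hΓ : CommonKnowledge.GCProves α (Ordinal.omega0 * (n : Ordinal.{v})) Γ) :
    CommonKnowledge.GCProves
      (Ordinal.omega0 * ((Ordinal.veblen 1)^[n] (Ordinal.omega0 * α) + 1)) 0 Γ := by
  cases n with
  | zero =>
    rw [Nat.cast_zero, mul_zero] at hΓ
    -- With cut rank `0` the proof is already cut-free, and only the depth bound has to be enlarged.
    refine hΓ.mono ?_
    calc α ≤ Ordinal.omega0 * α := Ordinal.le_mul_right _ Ordinal.omega0_pos
      _ ≤ Ordinal.omega0 * α + 1 := le_self_add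
      _ ≤ Ordinal.omega0 * (Ordinal.omega0 * α + 1) := Ordinal.le_mul_right _ Ordinal.omega0_pos
  | succ n =>
    obtain ⟨π, -⟩ := hΓ
    obtain ⟨β, hβ, H⟩ := CommonKnowledge.provableBelow_of_valid.{u, v} Γ fun W R V w => π.sound w
    refine H.mono (hβ.le.trans ?_)
    rw [Function.iterate_succ_apply']
    -- One application of `veblen 1` already brings the bound up to `ω * ω`.
    exact mul_le_mul_right ((CommonKnowledge.omega0_le_veblen_one _).trans le_self_add) _
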